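/- **Conventions.** For a cardinal $\kappa$, $[A]^{<\kappa}$ is the set of subsets of $A$ of cardinality $<\kappa$; $[A]^{\aleph_0}$ is the set of countably infinite subsets of $A$. ${}^{\mu>}A$ is the set of sequences of elements of $A$ of ordinal length $<\mu$, and ${}^{\mu}A$ the set of those of length $\mu$. **The game.** Let $\mu$ be a regular uncountable cardinal, $A$ a set and $\mathcal A\subseteq{}^{\mu>}A$. In the game $\mathcal G^{{}^{\mu>}A}(\mathcal A)$ of length $\mu$, in each round $\xi<\mu$ player I chooses $a_\xi\in A$ and then player II chooses $b_\xi\in A$. Write $\langle a_\xi,b_\xi:\xi<\eta\rangle$ for the sequence $f$ of length $2\cdot\eta$ with $f(2\cdot\xi)=a_\xi$, $f(2\cdot\xi+1)=b_\xi$. Player II wins the match if either $\langle a_\xi,b_\xi:\xi<\eta\rangle\in\mathcal A$ and $\langle a_\xi,b_\xi:\xi<\eta\rangle^\frown\langle a_\eta\rangle\notin\mathcal A$ for some $\eta<\mu$, or all restrictions of $\langle a_\xi,b_\xi:\xi<\mu\rangle$ to ordinals $\alpha<\mu$ are in $\mathcal A$. **Game reflection.** For regular uncountable cardinals $\mu<\kappa$,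 a set $\mathcal C\subseteq[A]^{<\kappa}$ is *$\mu$-club* if it is cofinal in $([A]^{<\kappa},\subseteq)$ and closed under unions of $\subseteq$-increasing chains of length $\nu$ for every regular $\nu$ with $\mu\le\nu<\kappa$. $\mathsf{GRP}^{<\mu}(<\kappa)$ is the statement: for every set $A$ of regular cardinality $\ge\kappa$, every $\mu$-club $\mathcal C\subseteq[A]^{<\kappa}$ and every $\mathcal A\subseteq{}^{\mu>}A$, if player II has no winning strategy in $\mathcal G^{{}^{\mu>}A}(\mathcal A)$, then there is $B\in\mathcal C$ such that player II has no winning strategy in $\mathcal G^{{}^{\mu>}B}(\mathcal A\cap{}^{\mu>}B)$. For regular $\kappa>\aleph_1$, $\mathsf{GRP}(<\kappa)$ denotes $\mathsf{GRP}^{<\omega_1}(<\kappa)$, and $\mathsf{GRP}$ denotes $\mathsf{GRP}(<\aleph_2)$. **Stationary logic.** $\mathcal L^{\aleph_0}_{stat}$ extends first-order logic by monadic second-order variables $X$ ranging over $[A]^{\aleph_0}$, where $A$ is the underlying set of the structure, by atomic formulas $x\mathrel{\varepsilon}X$ (interpreted as membership), and by one second-order quantifier: $\mathfrak A\models stat\,X\,\varphi(X,\dots)$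 iff $\{U\in[A]^{\aleph_0}:\mathfrak A\models\varphi(U,\dots)\}$ is stationary in $[A]^{\aleph_0}$, that is, meets every subset of $[A]^{\aleph_0}$ that is $\subseteq$-cofinal and closed under unions of increasing $\omega$-chains. For a substructure $\mathfrak B$ of $\mathfrak A$ with underlying set $B$, $\mathfrak B\prec_{\mathcal L^{\aleph_0}_{stat}}\mathfrak A$ means that for all formulas $\varphi$ of this logic, all $b_0,\dots\in B$ and all $U_0,\dots\in[B]^{\aleph_0}$, $\mathfrak B\models\varphi(b_0,\dots,U_0,\dots)$ iff $\mathfrak A\models\varphi(b_0,\dots,U_0,\dots)$. $\mathsf{SDLS}(\mathcal L^{\aleph_0}_{stat},<\kappa)$ is the statement: every uncountable first-order structure $\mathfrak A$ in a countable signature has a substructure $\mathfrak B$ of cardinality $<\kappa$ with $\mathfrak B\prec_{\mathcal L^{\aleph_0}_{stat}}\mathfrak A$. $\mathsf{SDLS}(\mathcal L^{\aleph_0}_{stat},\le\mu)$ means $\mathsf{SDLS}(\mathcal L^{\aleph_0}_{stat},<\mu^+)$. **Corollary.** (1) $\mathsf{GRP}$ implies $\mathsf{SDLS}(\mathcal L^{\aleph_0}_{stat},<\aleph_2)$.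 (2) $\mathsf{GRP}(<(2^{\aleph_0})^+)$ implies $\mathsf{SDLS}(\mathcal L^{\aleph_0}_{stat},\le 2^{\aleph_0})$. -/

import Mathlib

open Cardinal

universe u v w

/-! ### Sequences of ordinal length -/

/-- A sequence of elements of `A` indexed by the ordinals below `length`. -/
structure OSeq (A : Type u) : Type (u + 1) where
  length : Ordinal.{u}
  val : Set.Iio length → A

namespace OSeq

/-- The restriction `t ↾ α`, of length `min α (length t)`. -/
noncomputable def restrict {A : Type u} (t : OSeq A) (α : Ordinal.{u}) : OSeq A where
  length := min α t.length
  val := fun i => t.val ⟨i.1, lt_of_lt_of_le (Set.mem_Iio.1 i.2) (min_le_right _ _)⟩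

/-- The sequence `i ↦ g (t i)`. -/
def map {A B : Type u} (g : A → B) (t : OSeq A) : OSeq B where
  length := t.length
  val := fun i => g (t.val i)

end OSeq

/-- The set of all sequences in `A` of length `< μ`. -/
def seqsBelow (A : Type u) (μ : Cardinal.{u}) : Set (OSeq A) := {t | t.length < μ.ord}

/-! ### The game of length `μ` for `𝒜 ⊆ seqsBelow A μ`

A match is recorded as a single sequence `f` of length `μ` (note `2 * μ = μ` as ordinals): the
`ξ`-th move of player I is `f (2 * ξ)` and the `ξ`-th move of player II is `f (2 * ξ + 1)`.
So the moves made in the rounds `ξ < η` form `f ↾ (2 * η)`. (In Mathlib, `2 * ξ` for ordinals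
is the sum of `ξ` copies of `2`.) -/

/-- Player II wins the match `f`. -/
def IIWinsMatch {A : Type u} (μ : Cardinal.{u}) (𝒜 : Set (OSeq A)) (f : OSeq A) : Prop :=
  (∃ η < μ.ord, f.restrict (2 * η) ∈ 𝒜 ∧ f.restrict (2 * η + 1) ∉ 𝒜) ∨
    (∀ α < μ.ord, f.restrict α ∈ 𝒜)

/-- In `f`, each move of player II is the answer of `σ` to the moves made so far. -/
def FollowsII {A : Type u} (σ : OSeq A → A) (f : OSeq A) : Prop :=
  ∀ (ξ : Ordinal.{u}) (h : 2 * ξ + 1 < f.length),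
    f.val ⟨2 * ξ + 1, h⟩ = σ (f.restrict (2 * ξ + 1))

/-- Player II has a winning strategy in the game of length `μ` on `A` given by `𝒜`. -/
def IIHasWinningStrategy {A : Type u} (μ : Cardinal.{u}) (𝒜 : Set (OSeq A)) : Prop :=
  ∃ σ : OSeq A → A, ∀ f : OSeq A, f.length = μ.ord → FollowsII σ f → IIWinsMatch μ 𝒜 f

/-- The members of `𝒜` all of whose entries are in `B`, as a set of sequences in `B`. -/
def seqsIn {A : Type u} (𝒜 : Set (OSeq A)) (B : Set A) : Set (OSeq B) :=
  {t | t.map (fun b : B => (b : A)) ∈ 𝒜}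

/-! ### Game reflection -/

/-- `𝒞` is a `μ`-club subset of `[A]^{<κ}`. -/
structure IsMuClub {A : Type u} (μ κ : Cardinal.{u}) (𝒞 : Set (Set A)) : Prop where
  card_lt : ∀ X ∈ 𝒞, #X < κ
  cofinal : ∀ X : Set A, #X < κ → ∃ Y ∈ 𝒞, X ⊆ Y
  closed : ∀ ν : Cardinal.{u}, ν.IsRegular → μ ≤ ν → ν < κ →
    ∀ c : Set.Iio ν.ord → Set A, (∀ i, c i ∈ 𝒞) → Monotone c → (⋃ i, c i) ∈ 𝒞

/-- The principle `GRP^{<μ}(<κ)`, for regular uncountable cardinals `μ < κ`. -/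
def GRPGen (μ κ : Cardinal.{u}) : Prop :=
  ∀ (A : Type u), (#A).IsRegular → κ ≤ #A →
    ∀ 𝒞 : Set (Set A), IsMuClub μ κ 𝒞 →
      ∀ 𝒜 : Set (OSeq A), 𝒜 ⊆ seqsBelow A μ →
        ¬ IIHasWinningStrategy μ 𝒜 →
          ∃ B ∈ 𝒞, ¬ IIHasWinningStrategy μ (seqsIn 𝒜 B)

/-- `GRP(<κ)`, that is, `GRP^{<ω₁}(<κ)`. -/
def GRPLT (κ : Cardinal.{u}) : Prop := GRPGen (aleph 1) κ

/-- The Game Reflection Principle `GRP`, that is, `GRP(<ℵ₂)`. -/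
def GRP : Prop := GRPLT (aleph.{u} 2)

/-! ### Stationary logic -/

/-- `[A]^{ℵ₀}`, the set of countably infinite subsets of `A`. -/
def ctblSubsets (A : Type u) : Set (Set A) := {U | U.Countable ∧ U.Infinite}

/-- `C` is a closed unbounded subset of `[A]^{ℵ₀}`. -/
structure IsClubCtbl {A : Type u} (C : Set (Set A)) : Prop where
  subset : C ⊆ ctblSubsets A
  unbounded : ∀ U ∈ ctblSubsets A, ∃ W ∈ C, U ⊆ W
  closed : ∀ c : ℕ → Set A, (∀ n, c n ∈ C) → Monotone c → (⋃ n, c n) ∈ C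

/-- `S` is a stationary subset of `[A]^{ℵ₀}`. -/
def IsStationaryCtbl {A : Type u} (S : Set (Set A)) : Prop :=
  S ⊆ ctblSubsets A ∧ ∀ C : Set (Set A), IsClubCtbl C → (S ∩ C).Nonempty

/-- Formulas of stationary logic over the signature `L`, with free first-order variables among
`x₀, …, x_{m-1}` and free second-order variables among `X₀, …, X_{n-1}`. A quantifier binds the
last variable of its kind. -/
inductive StatFormula (L : FirstOrder.Language.{v, w}) : ℕ → ℕ → Type (max v w)
  | falsum {m n : ℕ} : StatFormula L m n
  | equal {m n : ℕ} (s t : L.Term (Fin m)) : StatFormula L m n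
  | rel {m n k : ℕ} (R : L.Relations k) (ts : Fin k → L.Term (Fin m)) : StatFormula L m n
  | mem {m n : ℕ} (x : Fin m) (X : Fin n) : StatFormula L m n
  | imp {m n : ℕ} (φ ψ : StatFormula L m n) : StatFormula L m n
  | all {m n : ℕ} (φ : StatFormula L (m + 1) n) : StatFormula L m n
  | stat {m n : ℕ} (φ : StatFormula L m (n + 1)) : StatFormula L m n

/-- Truth of a formula in the structure `A`, where `a` and `U` give the values of the first-order
and the second-order variables. -/
def StatFormula.Realize {L : FirstOrder.Language.{v, w}} {A : Type u} [L.Structure A] :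
    {m n : ℕ} → StatFormula L m n → (Fin m → A) → (Fin n → Set A) → Prop
  | _, _, .falsum, _, _ => False
  | _, _, .equal s t, a, _ => s.realize a = t.realize a
  | _, _, .rel R ts, a, _ => FirstOrder.Language.Structure.RelMap R (fun i => (ts i).realize a)
  | _, _, .mem x X, a, U => a x ∈ U X
  | _, _, .imp φ ψ, a, U => φ.Realize a U → ψ.Realize a U
  | _, _, .all φ, a, U => ∀ x : A, φ.Realize (Fin.snoc a x) U
  | _, _, .stat φ, a, U =>
      IsStationaryCtbl {X : Set A | X ∈ ctblSubsets A ∧ φ.Realize a (Fin.snoc U X)}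

/-- `B` is an elementary submodel of `A` with respect to stationary logic, with first-order
parameters from `B` and second-order parameters from `[B]^{ℵ₀}`. -/
def IsStatElementary {L : FirstOrder.Language.{v, w}} {A : Type u} [L.Structure A]
    (B : L.Substructure A) : Prop :=
  ∀ (m n : ℕ) (φ : StatFormula L m n) (b : Fin m → B) (U : Fin n → Set B),
    (∀ i, U i ∈ ctblSubsets B) →
      (φ.Realize b U ↔
        φ.Realize (fun i => (b i : A)) (fun i => (fun x : B => (x : A)) '' U i))

/-- `SDLS(L_stat^{ℵ₀}, <κ)`. -/
def SDLSStatLT (κ : Cardinal.{u}) : Prop :=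
  ∀ (L : FirstOrder.Language.{v, w}), L.card ≤ ℵ₀ →
    ∀ (A : Type u) [L.Structure A], ℵ₀ < #A →
      ∃ B : L.Substructure A, #B < κ ∧ IsStatElementary B

/-- `SDLS(L_stat^{ℵ₀}, ≤μ)`, that is, `SDLS(L_stat^{ℵ₀}, <μ⁺)`. -/
def SDLSStatLE (μ : Cardinal.{u}) : Prop := SDLSStatLT.{u, v, w} (Order.succ μ)

/-!
The theorem is reduced to a diagonal reflection principle for stationary sets, which game
reflection yields directly, without generic embeddings.

*Games.* For an even number `2 * δ` of moves below `ω₁` and any condition `W` on sequences of that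
length there is a payoff set `decidedAt` for which player II wins exactly if the first `2 * δ` moves
satisfy `W` (`IIWinsMatch_decidedAt`).

*The continuum.* If player II plays a real digit by digit and player I then has to name it, player
II has no winning strategy on a set containing names for all reals, but has one on a set with fewer
than `2 ^ ℵ₀` elements, by playing a real without a name. Hence `GRP(<κ)` implies `2 ^ ℵ₀ < κ`
(`two_pow_aleph0_lt_of_GRPLT`). In particular `GRP` implies the continuum hypothesis, so that
`ℵ₂ = (2 ^ ℵ₀)⁺` and the first claim is an instance of the second.

*Diagonal reflection* (`exists_reflecting_of_GRPLT`). Let `Y` be a set of large regular cardinality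
whose elements code both elements of `A` and families of countable subsets of `A`. Player II first
names a stationary family `p`, and wins if the set of elements of `A` played in `ω` rounds is not in
`p`. On `Y` there is no winning strategy, since a stationary `p` has a member closed under the
answers of a given strategy, and player I can enumerate it. So there is a `K ⊆ Y` of size at most
`2 ^ ℵ₀` on which player II has no winning strategy, and `K` can be taken closed under any given
countably many functions of countably many arguments, as such sets form an `ω₁`-club
(`isMuClub_seqClosed`). Let `B` be the set of elements of `A` coded in `K`. If `K` names a
stationary `p`, then the trace of `p` on `[B]^{ℵ₀}` is stationary: otherwise player II would win on
`K` by naming `p` and driving the play into a club disjoint from the trace. Conversely, closure of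
`K` under functions into clubs makes the traces of nonstationary families nonstationary.

*Elementarity.* Applied to the definable families `{X | φ(X, b, U)}` and to Skolem functions, with
parameters `b` and `U` coded by `ω`-sequences, this gives a substructure that passes a Tarski–Vaught
test for stationary logic (`isStatElementary_of_witnesses_of_reflection`).
-/

/-! ### Plays of the game -/

namespace OSeq

variable {A : Type u}

theorem ext_of_val {s t : OSeq A} (h : s.length = t.length)
    (hv : ∀ i (hs : i < s.length) (ht : i < t.length), s.val ⟨i, hs⟩ = t.val ⟨i, ht⟩) : s = t := by
  obtain ⟨l, a⟩ := s
  obtain ⟨l', b⟩ := t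
  obtain rfl : l = l' := h
  congr
  funext i
  exact hv i.1 i.2 i.2

/-- The entry of `t` at `i`, with an arbitrary value beyond the length of `t`. -/
noncomputable def entry [Nonempty A] (t : OSeq A) (i : Ordinal.{u}) : A := by
  classical exact if h : i < t.length then t.val ⟨i, h⟩ else Classical.arbitrary A

theorem entry_of_lt [Nonempty A] (t : OSeq A) {i : Ordinal.{u}} (h : i < t.length) :
    t.entry i = t.val ⟨i, h⟩ := by
  simp [entry, h]

theorem entry_restrict [Nonempty A] (t : OSeq A) {i α : Ordinal.{u}} (h : i < α) :
    (t.restrict α).entry i = t.entry i := by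
  by_cases hi : i < t.length
  · rw [entry_of_lt _ hi, entry_of_lt (t.restrict α) (lt_min h hi)]
    rfl
  · have : ¬ i < (t.restrict α).length := fun h' => hi (h'.trans_le (min_le_right _ _))
    simp [entry, hi, this]

theorem entry_map {B : Type u} [Nonempty A] [Nonempty B] (g : A → B) (t : OSeq A) {i : Ordinal.{u}}
    (h : i < t.length) : (t.map g).entry i = g (t.entry i) := by
  rw [entry_of_lt _ h, entry_of_lt (t.map g) h]
  rfl

theorem restrict_restrict (t : OSeq A) {α β : Ordinal.{u}} (h : α ≤ β) :
    (t.restrict β).restrict α = t.restrict α := by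
  refine ext_of_val ?_ fun _ _ _ => rfl
  change min α (min β t.length) = min α t.length
  rw [← min_assoc, min_eq_left h]

theorem restrict_length (t : OSeq A) {α : Ordinal.{u}} (h : α ≤ t.length) :
    (t.restrict α).length = α :=
  min_eq_left h

/-- The number of the round in which player II has to answer the moves recorded in `t`, for `t`
of finite length. -/
noncomputable def round (t : OSeq A) : ℕ := toNat t.length.card / 2

theorem round_restrict (t : OSeq A) (n : ℕ) (h : (2 * n + 1 : Ordinal.{u}) < t.length) :
    (t.restrict (2 * n + 1)).round = n := by
  have : (2 * n + 1 : Ordinal.{u}) = ((2 * n + 1 : ℕ) : Ordinal.{u}) := by push_cast; rfl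
  rw [round, restrict_length _ h.le, this, Ordinal.card_nat, toNat_natCast]
  omega

end OSeq

theorem IIWinsMatch_seqsIn {A : Type u} {B : Set A} {μ : Cardinal.{u}} {𝒜 : Set (OSeq A)}
    {f : OSeq B} :
    IIWinsMatch μ (seqsIn 𝒜 B) f ↔ IIWinsMatch μ 𝒜 (f.map fun b : B => (b : A)) :=
  Iff.rfl

/-- The set of sequences for which a match is decided by its first `δ` moves: player II wins
exactly if these satisfy `W`. -/
def decidedAt {A : Type u} (μ : Cardinal.{u}) (δ : Ordinal.{u}) (W : OSeq A → Prop) :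
    Set (OSeq A) :=
  {t | t.length < μ.ord ∧ (δ ≤ t.length → W (t.restrict δ))}

theorem decidedAt_subset {A : Type u} (μ : Cardinal.{u}) (δ : Ordinal.{u}) (W : OSeq A → Prop) :
    decidedAt μ δ W ⊆ seqsBelow A μ :=
  fun _ h => h.1

/-- As the number of moves is even, it is never player I's move that leads out of `decidedAt`. -/
theorem IIWinsMatch_decidedAt {A : Type u} {μ : Cardinal.{u}} (hμ : ℵ₀ ≤ μ) {δ : Ordinal.{u}}
    (hδ : 2 * δ < μ.ord) {W : OSeq A → Prop} {f : OSeq A} (hf : f.length = μ.ord) :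
    IIWinsMatch μ (decidedAt μ (2 * δ) W) f ↔ W (f.restrict (2 * δ)) := by
  have hlen : ∀ α < μ.ord, (f.restrict α).length = α := fun α hα =>
    f.restrict_length (hf ▸ hα.le)
  have hres : ∀ α < μ.ord, 2 * δ ≤ α → (f.restrict α).restrict (2 * δ) = f.restrict (2 * δ) :=
    fun α _ h => f.restrict_restrict h
  constructor
  · rintro (⟨η, hη, h1, h2⟩ | h)
    · by_contra hW
      have hlt : 2 * η < μ.ord := by
        by_contra! hle
        have e1 : f.restrict (2 * η) = f := by
          refine OSeq.ext_of_val (min_eq_right (hf ▸ hle)) fun _ _ _ => rfl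
        have := h1.1
        rw [e1, hf] at this
        exact this.false
      have hlt' : 2 * η + 1 < μ.ord := (isSuccLimit_ord hμ).succ_lt hlt
      have h3 : 2 * η < 2 * δ := by
        by_contra! hle
        have := h1.2 (by rwa [hlen _ hlt])
        rw [hres _ hlt hle] at this
        exact hW this
      have h4 : η + 1 ≤ δ := Order.succ_le_of_lt (lt_of_mul_lt_mul_left h3 zero_le)
      have h5 : 2 * η + 1 < 2 * δ := by
        calc 2 * η + 1 < 2 * η + 2 := by gcongr; exact one_lt_two
          _ = 2 * (η + 1) := by rw [mul_add, mul_one]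
          _ ≤ 2 * δ := by gcongr
      refine h2 ⟨by rwa [hlen _ hlt'], fun h => ?_⟩
      rw [hlen _ hlt'] at h
      exact absurd h h5.not_ge
    · have := (h _ hδ).2 (hlen _ hδ).ge
      rwa [hres _ hδ le_rfl] at this
  · intro h
    refine Or.inr fun α hα => ⟨by rwa [hlen _ hα], fun h' => ?_⟩
    rw [hlen _ hα] at h'
    rwa [hres _ hα h']

/-- The play, of unbounded length, in which player I makes the moves `a` and player II
answers by `σ`. -/
noncomputable def playAgainst {A : Type u} (σ : OSeq A → A) (a : Ordinal.{u} → A) :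
    Ordinal.{u} → A :=
  WellFoundedLT.fix (motive := fun _ => A) fun i g => by
    classical exact if i % 2 = 0 then a (i / 2) else σ ⟨i, fun j => g j.1 j.2⟩

section playAgainst

variable {A : Type u} (σ : OSeq A → A) (a : Ordinal.{u} → A)

theorem playAgainst_eq (i : Ordinal.{u}) : playAgainst σ a i =
    open Classical in
    if i % 2 = 0 then a (i / 2) else σ ⟨i, fun j => playAgainst σ a j.1⟩ := by
  conv_lhs => rw [playAgainst, WellFoundedLT.fix_eq]
  rfl

theorem playAgainst_two_mul (ξ : Ordinal.{u}) : playAgainst σ a (2 * ξ) = a ξ := by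
  rw [playAgainst_eq, if_pos (by simp), Ordinal.mul_div_cancel _ two_ne_zero]

theorem playAgainst_two_mul_add_one (ξ : Ordinal.{u}) : playAgainst σ a (2 * ξ + 1) =
    σ ⟨2 * ξ + 1, fun j => playAgainst σ a j.1⟩ := by
  rw [playAgainst_eq, if_neg]
  rw [Ordinal.mul_add_mod_self, Ordinal.mod_eq_of_lt one_lt_two]
  exact one_ne_zero

theorem playAgainst_congr {a a' : Ordinal.{u} → A} (i : Ordinal.{u})
    (h : ∀ ξ, 2 * ξ ≤ i → a ξ = a' ξ) : playAgainst σ a i = playAgainst σ a' i := by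
  induction i using WellFoundedLT.induction with
  | ind i ih =>
    rw [playAgainst_eq, playAgainst_eq]
    split_ifs
    · exact h _ (Ordinal.mul_div_le _ _)
    · congr 2
      funext j
      exact ih j.1 j.2 fun ξ hξ => h ξ (hξ.trans (le_of_lt j.2))

theorem followsII_playAgainst (μ : Ordinal.{u}) :
    FollowsII σ ⟨μ, fun i => playAgainst σ a i.1⟩ := by
  intro ξ h
  refine (playAgainst_two_mul_add_one σ a ξ).trans (congrArg σ ?_)
  exact OSeq.ext_of_val (min_eq_left h.le).symm fun _ _ _ => rfl

end playAgainst

/-- Player II has no winning strategy in a game decided by the first `2 * δ` moves, if against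
each strategy of player II some moves of player I lead to a loss of player II. -/
theorem not_IIHasWinningStrategy_decidedAt {A : Type u} [Nonempty A] {μ : Cardinal.{u}}
    (hμ : ℵ₀ ≤ μ) {δ : Ordinal.{u}} (hδ : 2 * δ < μ.ord) {W : OSeq A → Prop}
    (h : ∀ σ : OSeq A → A, ∃ a : Ordinal.{u} → A, ∀ t : OSeq A,
      (∀ i < 2 * δ, t.entry i = playAgainst σ a i) → ¬ W t) :
    ¬ IIHasWinningStrategy μ (decidedAt μ (2 * δ) W) := by
  rintro ⟨σ, hσ⟩
  obtain ⟨a, ha⟩ := h σ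
  have := hσ ⟨μ.ord, fun i => playAgainst σ a i.1⟩ rfl (followsII_playAgainst σ a _)
  rw [IIWinsMatch_decidedAt hμ hδ rfl] at this
  refine ha _ (fun i hi => ?_) this
  rw [OSeq.entry_restrict _ hi, OSeq.entry_of_lt _ (hi.trans hδ)]

/-- Player II has a winning strategy in the game on `B` if some strategy ensures `W`. -/
theorem IIHasWinningStrategy_seqsIn_decidedAt {A : Type u} {B : Set A}
    [Nonempty A] [Nonempty B] {μ : Cardinal.{u}}
    (hμ : ℵ₀ ≤ μ) {δ : Ordinal.{u}} (hδ : 2 * δ < μ.ord) {W : OSeq A → Prop} (σ : OSeq B → B)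
    (h : ∀ (f : Ordinal.{u} → B) (t : OSeq A), (∀ i < 2 * δ, t.entry i = f i) →
      (∀ n : ℕ, ∃ s : OSeq B, s.round = n ∧ (∀ i < (2 * n + 1 : Ordinal.{u}), s.entry i = f i) ∧
        f (2 * n + 1) = σ s) → W t) :
    IIHasWinningStrategy μ (seqsIn (decidedAt μ (2 * δ) W) B) := by
  refine ⟨σ, fun f hf hfol => ?_⟩
  rw [IIWinsMatch_seqsIn, IIWinsMatch_decidedAt (f := f.map fun b : B => (b : A)) hμ hδ hf]
  refine h f.entry _ (fun i hi => ?_) fun n => ⟨f.restrict (2 * n + 1), ?_, ?_, ?_⟩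
  · rw [OSeq.entry_restrict _ hi, OSeq.entry_map _ _ (hf ▸ hi.trans hδ)]
  all_goals
    have hn : (2 * n + 1 : Ordinal.{u}) < f.length := by
      have : (2 * n + 1 : Ordinal.{u}) = ((2 * n + 1 : ℕ) : Ordinal.{u}) := by push_cast; rfl
      rw [hf, this, lt_ord, Ordinal.card_nat]
      exact (natCast_lt_aleph0).trans_le hμ
  · exact OSeq.round_restrict _ _ hn
  · exact fun i hi => OSeq.entry_restrict _ hi
  · rw [OSeq.entry_of_lt _ hn]
    exact hfol n hn

/-! ### Closure under functions of countably many arguments -/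

theorem mk_iUnion_chain_lt {A : Type u} {ν κ : Cardinal.{u}} (hκ : κ.IsRegular) (hν : ν < κ)
    {c : Set.Iio ν.ord → Set A} (hc : ∀ i, #(c i) < κ) : #(⋃ i, c i : Set A) < κ := by
  have : (⋃ i, c i) = ⋃ j : ν.ord.ToType, c (Ordinal.ToType.mk.symm j) :=
    (Ordinal.ToType.mk.symm.surjective.iUnion_comp c).symm
  rw [this, card_iUnion_lt_iff_forall_of_isRegular hκ (by rwa [mk_ord_toType])]
  exact fun j => hc _

theorem exists_forall_mem_chain {A : Type u} {ν : Cardinal.{u}} (hν : ν.IsRegular)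
    (h1 : aleph 1 ≤ ν) {c : Set.Iio ν.ord → Set A} (hc : Monotone c) {s : ℕ → A}
    (hs : ∀ n, s n ∈ ⋃ i, c i) : ∃ i, ∀ n, s n ∈ c i := by
  simp only [Set.mem_iUnion] at hs
  choose i hi using hs
  have hlt : (⨆ n, (i n).1) < ν.ord := by
    refine Ordinal.lift_iSup_lt_of_lt_cof ?_ fun n => (i n).2
    rw [Ordinal.lift_id'.{0, u}, hν.cof_ord]
    simpa using aleph0_lt_aleph_one.trans_le h1
  exact ⟨⟨_, hlt⟩, fun n => hc (a := i n) (b := ⟨_, hlt⟩)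
    (Ordinal.le_iSup (fun n => (i n).1) n) (hi n)⟩

/-- `B` is closed under the set-valued function `G` of countably many arguments. -/
def SeqClosed {A : Type u} (G : (ℕ → A) → Set A) (B : Set A) : Prop :=
  ∀ s : ℕ → A, (∀ n, s n ∈ B) → G s ⊆ B

/-- The closure consists of the values of the well-founded terms built from constants for the
elements of `X` and countably many operations of arity `ℕ` which enumerate the values of `G`. -/
theorem exists_seqClosed_superset {A : Type u} {G : (ℕ → A) → Set A} (hG : ∀ s, (G s).Countable)
    {X : Set A} (hX : #X ≤ 2 ^ ℵ₀) : ∃ Y : Set A, X ⊆ Y ∧ #Y ≤ 2 ^ ℵ₀ ∧ SeqClosed G Y := by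
  by_cases hne : Nonempty A
  swap
  · exact ⟨X, subset_rfl, hX, fun s => (hne ⟨s 0⟩).elim⟩
  have hg : ∀ s, ∃ g : ℕ → A, G s ⊆ Set.range g := fun s => by
    rcases (G s).eq_empty_or_nonempty with h | h
    · exact ⟨fun _ => Classical.arbitrary A, by simp [h]⟩
    · obtain ⟨g, hg⟩ := (hG s).exists_eq_range h
      exact ⟨g, hg.le⟩
  choose g hg using hg
  let β : X ⊕ ℕ → Type := Sum.elim (fun _ => Empty) fun _ => ℕ
  let ev : WType β → A := WType.elim A fun p => match p with
    | ⟨.inl x, _⟩ => x.1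
    | ⟨.inr k, f⟩ => g f k
  have hev : ∀ k (f : ℕ → WType β), ev (WType.mk (Sum.inr k) f) = g (fun n => ev (f n)) k :=
    fun k f => rfl
  refine ⟨Set.range ev, fun x hx => ⟨WType.mk (Sum.inl ⟨x, hx⟩) Empty.elim, rfl⟩, ?_, ?_⟩
  · refine mk_range_le.trans (WType.cardinalMk_le_of_le' ?_)
    have hterm : ∀ p, ((2 : Cardinal.{u}) ^ ℵ₀) ^ lift.{u} #(β p) ≤ 2 ^ ℵ₀ := by
      rintro (x | k)
      · simpa [β] using (one_lt_aleph0.trans aleph0_lt_continuum).le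
      · simp [β]
    refine (sum_le_sum _ _ hterm).trans ?_
    rw [sum_const']
    refine (mul_le_mul' (c := (2 : Cardinal.{u}) ^ ℵ₀) ?_ le_rfl).trans (mul_eq_self (cantor ℵ₀).le).le
    rw [mk_sum]
    refine add_le_of_le (cantor ℵ₀).le ?_ ?_
    · simpa using hX
    · simpa using (cantor ℵ₀).le
  · rintro s hs _ hy
    choose f hf using hs
    obtain ⟨k, rfl⟩ := hg s hy
    exact ⟨WType.mk (Sum.inr k) f, by rw [hev]; simp [hf]⟩

theorem isMuClub_seqClosed {A : Type u} {G : (ℕ → A) → Set A} (hG : ∀ s, (G s).Countable)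
    {Z : Set A} (hZ : #Z ≤ 2 ^ ℵ₀) :
    IsMuClub (aleph 1) (Order.succ (2 ^ ℵ₀))
      {B : Set A | #B ≤ 2 ^ ℵ₀ ∧ Z ⊆ B ∧ SeqClosed G B} where
  card_lt X hX := Order.lt_succ_of_le hX.1
  cofinal X hX := by
    have hXZ : #(X ∪ Z : Set A) ≤ 2 ^ ℵ₀ := (mk_union_le X Z).trans
      (add_le_of_le (cantor ℵ₀).le (Order.le_of_lt_succ hX) hZ)
    obtain ⟨Y, h1, h2, h3⟩ := exists_seqClosed_superset hG hXZ
    exact ⟨Y, ⟨h2, Set.subset_union_right.trans h1, h3⟩, Set.subset_union_left.trans h1⟩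
  closed ν hν h1 h2 c hc hmono := by
    refine ⟨Order.le_of_lt_succ (mk_iUnion_chain_lt
      (isRegular_succ (cantor ℵ₀).le) h2 fun i => Order.lt_succ_of_le (hc i).1),
      (hc ⟨0, hν.ord_pos⟩).2.1.trans (Set.subset_iUnion c _), fun s hs => ?_⟩
    obtain ⟨i, hi⟩ := exists_forall_mem_chain hν h1 hmono hs
    exact ((hc i).2.2 s hi).trans (Set.subset_iUnion c i)

/-- A superset of large regular cardinality, presented as a surjection onto `X`. -/
theorem exists_isRegular_surjective (κ : Cardinal.{u}) (X : Type u) [Nonempty X] :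
    ∃ (Y : Type u) (d : Y → X), (#Y).IsRegular ∧ κ ≤ #Y ∧ d.Surjective := by
  let μ : Cardinal.{u} := max (max κ #X) ℵ₀
  have hμ : #(Order.succ μ).out = Order.succ μ := mk_out _
  have hX : #X ≤ #(Order.succ μ).out := by
    rw [hμ]
    exact ((le_max_right _ _).trans (le_max_left _ _)).trans (Order.le_succ μ)
  obtain ⟨e⟩ := hX
  refine ⟨(Order.succ μ).out, Function.invFun e, ?_, ?_, Function.invFun_surjective e.injective⟩
  · rw [hμ]
    exact isRegular_succ (le_max_right _ _)
  · rw [hμ]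
    exact ((le_max_left _ _).trans (le_max_left _ _)).trans (Order.le_succ μ)

/-! ### Game reflection bounds the continuum -/

theorem ordinal_two_mul_omega0 : (2 : Ordinal.{u}) * Ordinal.omega0 = Ordinal.omega0 := by
  exact_mod_cast Ordinal.natCast_mul_omega0 (n := 2) two_pos

theorem omega0_lt_ord_aleph_one : Ordinal.omega0.{u} < (aleph 1).ord := by
  rw [lt_ord, Ordinal.card_omega0]
  exact aleph0_lt_aleph_one

theorem ordinal_two_mul_natCast_add_one_lt (n : ℕ) :
    (2 * n + 1 : Ordinal.{u}) < Ordinal.omega0 := by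
  have : (2 * n + 1 : Ordinal.{u}) = ((2 * n + 1 : ℕ) : Ordinal.{u}) := by push_cast; rfl
  rw [this]
  exact Ordinal.natCast_lt_omega0 _

/-- Player II plays a real bit by bit, which player I then has to name. This is impossible for
player I if only fewer than `2 ^ ℵ₀` reals have names. -/
theorem two_pow_aleph0_lt_of_GRPLT {κ : Cardinal.{u}} (hκ : κ.IsRegular)
    (h : GRPLT κ) : 2 ^ ℵ₀ < κ := by
  by_contra! hle
  -- Elements of `A` stand for reals; as a move of player II, they stand for the digit at `0`.
  obtain ⟨A, d, hA, hκA, hd⟩ := exists_isRegular_surjective κ (ULift.{u} (ℕ → Bool))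
  have hde : ∀ r, d (Function.surjInv hd r) = r := Function.surjInv_eq hd
  let name : (ℕ → Bool) → A := fun r => Function.surjInv hd ⟨r⟩
  have hname : ∀ r, (d (name r)).down = r := fun r => by simp [name, hde]
  have : Nonempty A := ⟨name fun _ => true⟩
  let Z : Set A := Set.range fun i : Bool => name fun _ => i
  have hZ : Z.Finite := Set.finite_range _
  have hclub : IsMuClub (aleph 1) κ {B : Set A | #B < κ ∧ Z ⊆ B} := by
    refine ⟨fun X hX => hX.1, fun X hX => ⟨X ∪ Z, ⟨?_, Set.subset_union_right⟩,
      Set.subset_union_left⟩, fun ν hν _ hνκ c hc _ =>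
        ⟨mk_iUnion_chain_lt hκ hνκ fun i => (hc i).1, ?_⟩⟩
    · exact (mk_union_le X Z).trans_lt
        (add_lt_of_lt hκ.aleph0_le hX (hZ.lt_aleph0.trans_le hκ.aleph0_le))
    · exact (hc ⟨0, hν.ord_pos⟩).2.trans (Set.subset_iUnion c _)
  -- Player I names a real at index `ω`. The game is decided one move later, since player II wins a
  -- match in which player I's move is the one that leaves the payoff set.
  let W : OSeq A → Prop := fun t =>
    (d (t.entry Ordinal.omega0)).down ≠ fun n : ℕ => (d (t.entry (2 * n + 1))).down 0
  have hδ : 2 * (Ordinal.omega0.{u} + 1) < (aleph 1).ord := by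
    have hs := isSuccLimit_ord (aleph0_le_aleph.{u} 1)
    rw [mul_add, ordinal_two_mul_omega0, mul_one, ← one_add_one_eq_two, ← add_assoc]
    exact hs.succ_lt (hs.succ_lt omega0_lt_ord_aleph_one)
  have hω : Ordinal.omega0.{u} < 2 * (Ordinal.omega0 + 1) := by
    conv_lhs => rw [← ordinal_two_mul_omega0]
    exact (mul_lt_mul_iff_right₀ two_pos).2 (lt_add_one _)
  have hn : ∀ n : ℕ, (2 * n + 1 : Ordinal.{u}) < 2 * (Ordinal.omega0 + 1) := fun n =>
    (ordinal_two_mul_natCast_add_one_lt n).trans hω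
  obtain ⟨B, ⟨hBκ, hZB⟩, hB⟩ := h A hA hκA _ hclub _ (decidedAt_subset _ _ W)
    (not_IIHasWinningStrategy_decidedAt (aleph0_le_aleph 1) hδ fun σ => by
      let r : ℕ → Bool := fun n =>
        (d (playAgainst σ (fun _ => Classical.arbitrary A) (2 * n + 1))).down 0
      refine ⟨fun ξ => if ξ < Ordinal.omega0 then Classical.arbitrary A else name r,
        fun t ht hW => hW ?_⟩
      have hnamed : t.entry Ordinal.omega0 = name r := by
        have := playAgainst_two_mul σ
          (fun ξ => if ξ < Ordinal.omega0 then Classical.arbitrary A else name r) Ordinal.omega0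
        rwa [ordinal_two_mul_omega0, if_neg (lt_irrefl _), ← ht _ hω] at this
      rw [hnamed, hname]
      funext n
      rw [ht _ (hn n), playAgainst_congr σ (2 * n + 1 : Ordinal)]
      intro ξ hξ
      refine if_pos (lt_of_mul_lt_mul_left (a := 2) ?_ zero_le)
      rw [ordinal_two_mul_omega0]
      exact hξ.trans_lt (ordinal_two_mul_natCast_add_one_lt n))
  obtain ⟨r, hr⟩ : ∃ r : ℕ → Bool, ∀ b ∈ B, (d b).down ≠ r := by
    by_contra! hall
    have : 2 ^ ℵ₀ ≤ #B := by
      have hsurj : Function.Surjective fun b : B => d b := fun r => by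
        obtain ⟨b, hb, hbr⟩ := hall r.down
        exact ⟨⟨b, hb⟩, ULift.ext _ _ hbr⟩
      simpa using mk_le_of_surjective hsurj
    exact absurd (this.trans_lt hBκ) hle.not_gt
  have hmem : ∀ i : Bool, name (fun _ => i) ∈ B := fun i => hZB ⟨i, rfl⟩
  have : Nonempty B := ⟨⟨_, hmem true⟩⟩
  refine hB (IIHasWinningStrategy_seqsIn_decidedAt (aleph0_le_aleph 1) hδ
    (fun s => ⟨_, hmem (r s.round)⟩) fun f t hft hf hW => ?_)
  rw [hft _ hω] at hW
  refine hr _ (f _).2 (hW.trans (funext fun n => ?_))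
  obtain ⟨s, hs, -, hfs⟩ := hf n
  rw [hft _ (hn n), hfs, hname, hs]

/-! ### Clubs and stationary sets of countable sets -/

theorem ctblSubsets_iUnion {A : Type u} {c : ℕ → Set A} (hc : ∀ n, c n ∈ ctblSubsets A) :
    (⋃ n, c n) ∈ ctblSubsets A :=
  ⟨Set.countable_iUnion fun n => (hc n).1, (hc 0).2.mono (Set.subset_iUnion c 0)⟩

theorem image_val_mem_ctblSubsets {A : Type u} {B : Set A} {X : Set B} :
    (fun x : B => (x : A)) '' X ∈ ctblSubsets A ↔ X ∈ ctblSubsets B := by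
  have hinj : Set.InjOn (fun x : B => (x : A)) X := Subtype.val_injective.injOn
  exact and_congr ⟨fun h => Set.countable_of_injective_of_countable_image hinj h,
    fun h => h.image _⟩ (Set.infinite_image_iff hinj)

theorem Monotone.exists_forall_mem_of_forall_mem_iUnion {A : Type u} {c : ℕ → Set A}
    (hmono : Monotone c) {l : List A} (hl : ∀ x ∈ l, x ∈ ⋃ n, c n) : ∃ n, ∀ x ∈ l, x ∈ c n := by
  induction l with
  | nil => exact ⟨0, by simp⟩
  | cons a l ih =>
    simp only [List.mem_cons, forall_eq_or_imp] at hl ⊢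
    obtain ⟨n, hn⟩ := ih hl.2
    obtain ⟨k, hk⟩ := Set.mem_iUnion.1 hl.1
    exact ⟨max k n, hmono (le_max_left _ _) hk,
      fun x hx => hmono (le_max_right _ _) (hn x hx)⟩

/-- The countably infinite sets that are closed under a function of finitely many arguments with
countable values form a club. -/
theorem isClubCtbl_listClosed {A : Type u} (F : List A → Set A) (hF : ∀ l, (F l).Countable) :
    IsClubCtbl {X : Set A | X ∈ ctblSubsets A ∧ ∀ l : List A, (∀ x ∈ l, x ∈ X) → F l ⊆ X} where
  subset _ h := h.1
  unbounded U hU := by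
    let c : ℕ → Set A := fun n => (fun X => X ∪ ⋃ l ∈ {l : List A | ∀ x ∈ l, x ∈ X}, F l)^[n] U
    have hsucc : ∀ n, c (n + 1) = c n ∪ ⋃ l ∈ {l : List A | ∀ x ∈ l, x ∈ c n}, F l := fun n =>
      Function.iterate_succ_apply' _ _ _
    have hmono : Monotone c := monotone_nat_of_le_succ fun n => by
      rw [hsucc]
      exact Set.subset_union_left
    have hct : ∀ n, c n ∈ ctblSubsets A := fun n => by
      induction n with
      | zero => exact hU
      | succ n ih =>
        rw [hsucc]
        refine ⟨ih.1.union (Set.Countable.biUnion ?_ fun l _ => hF l), ih.2.mono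
          Set.subset_union_left⟩
        have := ih.1.to_subtype
        rw [← Set.range_list_map_coe]
        exact Set.countable_range _
    refine ⟨⋃ n, c n, ⟨ctblSubsets_iUnion hct, fun l hl => ?_⟩, Set.subset_iUnion c 0⟩
    obtain ⟨n, hn⟩ := hmono.exists_forall_mem_of_forall_mem_iUnion hl
    refine Set.Subset.trans ?_ (Set.subset_iUnion c (n + 1))
    rw [hsucc]
    exact (Set.subset_biUnion_of_mem (s := {l : List A | ∀ x ∈ l, x ∈ c n}) (u := F) hn).trans
      Set.subset_union_right
  closed c hc hmono := by
    refine ⟨ctblSubsets_iUnion fun n => (hc n).1, fun l hl => ?_⟩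
    obtain ⟨n, hn⟩ := hmono.exists_forall_mem_of_forall_mem_iUnion hl
    exact ((hc n).2 l hn).trans (Set.subset_iUnion c n)

/-- The trace on `B` of a family of subsets of `A`. -/
def trace {A : Type u} (B : Set A) (S : Set (Set A)) : Set (Set B) :=
  {X | (fun x : B => (x : A)) '' X ∈ S}

theorem trace_subset {A : Type u} (B : Set A) {S : Set (Set A)} (hS : S ⊆ ctblSubsets A) :
    trace B S ⊆ ctblSubsets B :=
  fun _ hX => image_val_mem_ctblSubsets.1 (hS hX)

/-- A monotone choice of members of a club over finite lists. -/
theorem IsClubCtbl.exists_enumeration {A : Type u} {D : Set (Set A)} (hD : IsClubCtbl D)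
    (hne : (ctblSubsets A).Nonempty) : ∃ w : List A → ℕ → A, (∀ l, Set.range (w l) ∈ D) ∧
      ∀ x l, x ∈ Set.range (w (x :: l)) ∧ Set.range (w l) ⊆ Set.range (w (x :: l)) := by
  have h1 : ∀ X ∈ D, ∀ x, ∃ Y ∈ D, x ∈ Y ∧ X ⊆ Y := fun X hX x => by
    obtain ⟨Y, hY, hXY⟩ := hD.unbounded (insert x X)
      ⟨(hD.subset hX).1.insert x, (hD.subset hX).2.mono (Set.subset_insert _ _)⟩
    exact ⟨Y, hY, hXY (Set.mem_insert _ _), (Set.subset_insert _ _).trans hXY⟩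
  choose! next hnext hmem hsub using h1
  obtain ⟨U, hU⟩ := hne
  obtain ⟨X₀, hX₀, -⟩ := hD.unbounded U hU
  let V : List A → Set A := fun l => l.foldr (fun x X => next X x) X₀
  have hV : ∀ l, V l ∈ D := fun l => by
    induction l with
    | nil => exact hX₀
    | cons x l ih => exact hnext _ ih x
  have hw : ∀ l, ∃ f : ℕ → A, V l = Set.range f := fun l =>
    (hD.subset (hV l)).1.exists_eq_range (hD.subset (hV l)).2.nonempty
  choose w hw using hw
  refine ⟨w, fun l => hw l ▸ hV l, fun x l => ?_⟩
  rw [← hw, ← hw]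
  exact ⟨hmem _ (hV l) x, hsub _ (hV l) x⟩

theorem IsClubCtbl.trace {A : Type u} {C : Set (Set A)} (hC : IsClubCtbl C) {B : Set A}
    (hB : ∀ U ∈ ctblSubsets A, U ⊆ B → ∃ W ∈ C, U ⊆ W ∧ W ⊆ B) : IsClubCtbl (trace B C) where
  subset := trace_subset B hC.subset
  unbounded U hU := by
    obtain ⟨W, hW, hUW, hWB⟩ := hB _ (image_val_mem_ctblSubsets.2 hU)
      (by rintro _ ⟨x, -, rfl⟩; exact x.2)
    refine ⟨(fun x : B => (x : A)) ⁻¹' W, ?_, Set.image_subset_iff.1 hUW⟩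
    change _ '' _ ∈ C
    rwa [Set.image_preimage_eq_of_subset (by simpa using hWB)]
  closed c hc hmono := by
    change _ '' _ ∈ C
    rw [Set.image_iUnion]
    exact hC.closed _ hc fun i j h => Set.image_mono (hmono h)

/-! ### The diagonal reflection game -/

section diagonal

variable {A Y : Type u} [Nonempty Y] (d : Y → A × Set (Set A))

/-- The winning condition for player II in the diagonal reflection game. Its moves `y` stand for
elements `(d y).1` of `A` and families `(d y).2` of subsets of `A`. By the first move, player II has
to name a stationary family, and the elements of `A` played in the first `ω` rounds must form a
set outside this family. -/
def DiagonalWin (t : OSeq Y) : Prop :=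
  IsStationaryCtbl (d (t.entry 1)).2 ∧
    Set.range (fun n : ℕ => (d (t.entry n)).1) ∉ (d (t.entry 1)).2

theorem natCast_lt_two_mul_omega0 (n : ℕ) : (n : Ordinal.{u}) < 2 * Ordinal.omega0 := by
  rw [ordinal_two_mul_omega0]
  exact Ordinal.natCast_lt_omega0 n

theorem two_mul_omega0_lt : 2 * Ordinal.omega0.{u} < (aleph 1).ord := by
  rw [ordinal_two_mul_omega0]
  exact omega0_lt_ord_aleph_one

/-- A strategy of player II names a family `p` by a move that depends on the first move of player I
only. If `p` is stationary, then it has a member `X` closed under the answers of the strategy, and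
player I wins by enumerating `X`. -/
theorem not_IIHasWinningStrategy_diagonal (hd : d.Surjective) :
    ¬ IIHasWinningStrategy (aleph 1)
      (decidedAt (aleph 1) (2 * Ordinal.omega0) (DiagonalWin d)) := by
  refine not_IIHasWinningStrategy_decidedAt (aleph0_le_aleph 1) two_mul_omega0_lt fun σ => ?_
  have he : ∀ x : A, ∃ y, (d y).1 = x := fun x => by
    obtain ⟨y, hy⟩ := hd (x, ∅)
    exact ⟨y, by rw [hy]⟩
  choose e he using he
  let y₀ : Y := Classical.arbitrary Y
  let x₀ : A := (d y₀).1
  -- `mv l` are the moves of player I which stand for `x₀` followed by `l`, and `ans l` is the answer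
  -- to the last of them.
  let mv : List A → Ordinal.{u} → Y := fun l ξ => (y₀ :: l.map e).getD (toNat ξ.card) y₀
  let ans : List A → Y := fun l => playAgainst σ (mv l) (2 * l.length + 1)
  by_cases hstat : IsStationaryCtbl (d (ans [])).2
  swap
  · refine ⟨mv [], fun t ht hW => hstat ?_⟩
    have : t.entry 1 = ans [] := by
      rw [ht 1 (by exact_mod_cast natCast_lt_two_mul_omega0 1)]
      simp [ans]
    rw [← this]
    exact hW.1
  let F : List A → Set A := fun l => {x₀, (d (ans l)).1}
  obtain ⟨X, hXp, hX, hXF⟩ := hstat.2 _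
    (isClubCtbl_listClosed F fun l => (Set.countable_singleton _).insert _)
  obtain ⟨x, rfl⟩ := hX.1.exists_eq_range hX.2.nonempty
  let a : ℕ → Y := fun n => n.casesOn y₀ fun k => e (x k)
  let pre : ℕ → List A := fun n => (List.range n).map x
  have hans : ∀ n : ℕ,
      playAgainst σ (fun ξ => a (toNat ξ.card)) (2 * n + 1) = ans (pre n) := fun n => by
    have hlen : (pre n).length = n := by simp [pre]
    simp only [ans, hlen]
    refine playAgainst_congr σ _ fun ξ hξ => ?_
    have hξn : ξ ≤ n := by
      by_contra! hlt
      have h1 : (n : Ordinal.{u}) + 1 ≤ ξ := Order.succ_le_of_lt hlt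
      have h2 : (2 * n + 1 : Ordinal.{u}) < 2 * ξ := by
        calc (2 * n + 1 : Ordinal.{u}) < 2 * n + 2 := by gcongr; exact one_lt_two
          _ = 2 * (n + 1) := by rw [mul_add, mul_one]
          _ ≤ 2 * ξ := by gcongr
      exact absurd hξ h2.not_ge
    obtain ⟨k, rfl⟩ := Ordinal.lt_omega0.1 (hξn.trans_lt (Ordinal.natCast_lt_omega0 n))
    have hk : k ≤ n := by exact_mod_cast hξn
    simp only [mv, Ordinal.card_nat, toNat_natCast]
    cases k with
    | zero => rfl
    | succ k => simp [a, pre, List.getElem?_range (Nat.lt_of_succ_le hk)]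
  have hpre : ∀ n, F (pre n) ⊆ Set.range x := fun n => hXF _ (by simp [pre])
  refine ⟨fun ξ => a (toNat ξ.card), fun t ht hW => hW.2 ?_⟩
  have heven : ∀ n : ℕ, t.entry ((2 * n : ℕ) : Ordinal.{u}) = a n := fun n => by
    have h2n : ((2 * n : ℕ) : Ordinal.{u}) = 2 * n := by push_cast; rfl
    rw [ht _ (natCast_lt_two_mul_omega0 _), h2n, playAgainst_two_mul]
    simp
  have hodd : ∀ n : ℕ, t.entry ((2 * n + 1 : ℕ) : Ordinal.{u}) = ans (pre n) := fun n => by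
    rw [ht _ (natCast_lt_two_mul_omega0 _), ← hans]
    push_cast
    rfl
  have hp : t.entry 1 = ans [] := by simpa [pre] using hodd 0
  have hrange : Set.range (fun n : ℕ => (d (t.entry n)).1) = Set.range x := by
    refine Set.Subset.antisymm ?_ ?_
    · rintro _ ⟨i, rfl⟩
      obtain ⟨n, rfl | rfl⟩ := i.even_or_odd'
      · simp only [heven]
        cases n with
        | zero => exact hpre 0 (Set.mem_insert _ _)
        | succ n => exact ⟨n, (he _).symm⟩
      · simp only [hodd]
        exact hpre n (Set.mem_insert_of_mem _ rfl)
    · rintro _ ⟨n, rfl⟩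
      exact ⟨2 * (n + 1), by simp only [heven]; exact he _⟩
  rw [hrange, hp]
  exact hXp

/-- The list `[g (n - 1), …, g 0]`. -/
def revPrefix {B : Type u} (g : ℕ → B) : ℕ → List B
  | 0 => []
  | n + 1 => g n :: revPrefix g n

theorem revPrefix_congr {B : Type u} {g g' : ℕ → B} {n : ℕ} (h : ∀ k < n, g k = g' k) :
    revPrefix g n = revPrefix g' n := by
  induction n with
  | zero => rfl
  | succ n ih =>
    rw [revPrefix, revPrefix, h n n.lt_succ_self, ih fun k hk => h k (hk.trans n.lt_succ_self)]

/-- If the trace of a named stationary family is not stationary, then player II wins by naming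
this family and driving the play into a club which is disjoint from the trace. -/
theorem IIHasWinningStrategy_diagonal {K : Set Y} {y : Y} (hy : y ∈ K)
    (hstat : IsStationaryCtbl (d y).2)
    (hinf : (ctblSubsets ((fun y => (d y).1) '' K)).Nonempty)
    (hns : ¬ IsStationaryCtbl (trace ((fun y => (d y).1) '' K) (d y).2)) :
    IIHasWinningStrategy (aleph 1)
      (seqsIn (decidedAt (aleph 1) (2 * Ordinal.omega0) (DiagonalWin d)) K) := by
  have : Nonempty K := ⟨⟨y, hy⟩⟩
  set B : Set A := (fun y => (d y).1) '' K with hB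
  let val : K → B := fun k => ⟨(d k).1, k, k.2, rfl⟩
  have hval : ∀ b : B, ∃ k, val k = b := by
    rintro ⟨_, k, hk, rfl⟩
    exact ⟨⟨k, hk⟩, rfl⟩
  choose lift hlift using hval
  obtain ⟨D, hD, hDS⟩ : ∃ D : Set (Set B), IsClubCtbl D ∧ ¬ (trace B (d y).2 ∩ D).Nonempty := by
    by_contra! hall
    exact hns ⟨trace_subset B hstat.1, hall⟩
  obtain ⟨w, hwD, hw⟩ := hD.exists_enumeration hinf
  -- In round `Nat.pair i j + 1`, player II plays the `j`-th element of the member of `D` attached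
  -- to the first `i` moves.
  let σ : OSeq K → K := fun s => s.round.casesOn ⟨y, hy⟩ fun m =>
    lift (w (revPrefix (fun k => val (s.entry k)) m.unpair.1) m.unpair.2)
  refine IIHasWinningStrategy_seqsIn_decidedAt (aleph0_le_aleph 1) two_mul_omega0_lt σ
    fun f t htf hf => ?_
  have h1 : t.entry 1 = y := by
    obtain ⟨s, hs, -, hfs⟩ := hf 0
    rw [htf 1 (by exact_mod_cast natCast_lt_two_mul_omega0 1)]
    have : f 1 = σ s := by simpa using hfs
    rw [this]
    simp only [σ, hs]
    rfl
  let g : ℕ → B := fun n => val (f n)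
  have hg : ∀ i j, ∃ n, g n = w (revPrefix g i) j := fun i j => by
    obtain ⟨s, hs, hsf, hfs⟩ := hf (Nat.pair i j + 1)
    refine ⟨2 * (Nat.pair i j + 1) + 1, ?_⟩
    have h2 : f ((2 * (Nat.pair i j + 1) + 1 : ℕ) : Ordinal.{u}) = σ s := by
      rw [← hfs]
      push_cast
      rfl
    simp only [g, h2, σ, hs, Nat.unpair_pair, hlift]
    refine congrArg (fun l => w l j) (revPrefix_congr fun k hk => ?_)
    rw [hsf]
    have h3 : k < 2 * (Nat.pair i j + 1) + 1 := by
      have := Nat.left_le_pair i j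
      omega
    exact_mod_cast h3
  have hmono : Monotone fun i => Set.range (w (revPrefix g i)) :=
    monotone_nat_of_le_succ fun i => (hw _ _).2
  have hrange : Set.range g = ⋃ i, Set.range (w (revPrefix g i)) := by
    refine Set.Subset.antisymm ?_ (Set.iUnion_subset fun i => ?_)
    · rintro _ ⟨n, rfl⟩
      exact Set.mem_iUnion.2 ⟨n + 1, (hw _ _).1⟩
    · rintro _ ⟨j, rfl⟩
      exact hg i j
  have hgD : Set.range g ∈ D := hrange ▸ hD.closed _ (fun i => hwD _) hmono
  rw [DiagonalWin, h1]
  refine ⟨hstat, fun hmem => hDS ⟨Set.range g, ?_, hgD⟩⟩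
  have himage : (fun x : B => (x : A)) '' Set.range g =
      Set.range fun n : ℕ => (d (t.entry n)).1 := by
    rw [← Set.range_comp]
    congr 1
    funext n
    rw [htf _ (natCast_lt_two_mul_omega0 n)]
    rfl
  change (fun x : B => (x : A)) '' Set.range g ∈ (d y).2
  rwa [himage]

end diagonal

/-- Diagonal reflection: some set `B` of size at most `2 ^ ℵ₀` with prescribed closure properties
reflects, in both directions, the stationarity of all families of countable sets that are attached
to countably many elements of `B`. -/
theorem exists_reflecting_of_GRPLT (h : GRPLT.{u} (Order.succ (2 ^ ℵ₀))) {A : Type u} [Infinite A]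
    (G : (ℕ → A) → Set A) (hG : ∀ s, (G s).Countable)
    (S : (ℕ → A) → Set (Set (Set A))) (hS : ∀ s, (S s).Countable)
    (hSs : ∀ s, ∀ T ∈ S s, T ⊆ ctblSubsets A) :
    ∃ B : Set A, #B ≤ 2 ^ ℵ₀ ∧ B.Infinite ∧ SeqClosed G B ∧
      ∀ s : ℕ → A, (∀ n, s n ∈ B) → ∀ T ∈ S s,
        (IsStationaryCtbl T ↔ IsStationaryCtbl (trace B T)) := by
  obtain ⟨Y, d, hY, hκ, hd⟩ :=
    exists_isRegular_surjective (Order.succ (2 ^ ℵ₀)) (A × Set (Set A))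
  have : Nonempty Y := ⟨(hd (Classical.arbitrary A, ∅)).choose⟩
  have he : ∀ x : A, ∃ y, (d y).1 = x := fun x => by
    obtain ⟨y, hy⟩ := hd (x, ∅)
    exact ⟨y, by rw [hy]⟩
  have hc : ∀ T : Set (Set A), ∃ y, (d y).2 = T := fun T => by
    obtain ⟨y, hy⟩ := hd (Classical.arbitrary A, T)
    exact ⟨y, by rw [hy]⟩
  choose e he using he
  choose code hcode using hc
  -- `E T U` is a countable set that extends `U` to a member of a club disjoint from `T`,
  -- if `T` is not stationary.
  have hE : ∀ T : Set (Set A), ∃ C : Set (Set A), ∀ U : Set A, ∃ E : Set A, E.Countable ∧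
      (T ⊆ ctblSubsets A → ¬ IsStationaryCtbl T → IsClubCtbl C ∧ ¬ (T ∩ C).Nonempty ∧
        (U ∈ ctblSubsets A → E ∈ C ∧ U ⊆ E)) := fun T => by
    by_cases hT : T ⊆ ctblSubsets A ∧ ¬ IsStationaryCtbl T
    · obtain ⟨hT1, hT2⟩ := hT
      obtain ⟨C, hC, hTC⟩ : ∃ C, IsClubCtbl C ∧ ¬ (T ∩ C).Nonempty := by
        by_contra! hall
        exact hT2 ⟨hT1, hall⟩
      refine ⟨C, fun U => ?_⟩
      by_cases hU : U ∈ ctblSubsets A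
      · obtain ⟨W, hW, hUW⟩ := hC.unbounded U hU
        exact ⟨W, (hC.subset hW).1, fun _ _ => ⟨hC, hTC, fun _ => ⟨hW, hUW⟩⟩⟩
      · exact ⟨∅, Set.countable_empty, fun _ _ => ⟨hC, hTC, fun h => (hU h).elim⟩⟩
    · exact ⟨∅, fun U => ⟨∅, Set.countable_empty, fun h1 h2 => (hT ⟨h1, h2⟩).elim⟩⟩
  choose C E hEct hE using hE
  -- `z` makes `B` infinite, so that there are countably infinite subsets of `B`.
  let z : ℕ → A := Infinite.natEmbedding A
  -- In the last term, even entries code the parameters of a family and odd ones a countable set.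
  let H : (ℕ → Y) → Set Y := fun y =>
    e '' G (fun n => (d (y n)).1) ∪ code '' S (fun n => (d (y n)).1) ∪
      ⋃ T ∈ S (fun n => (d (y (2 * n))).1), e '' E T (Set.range fun n => (d (y (2 * n + 1))).1)
  have hH : ∀ y, (H y).Countable := fun y =>
    (((hG _).image _).union ((hS _).image _)).union
      ((hS _).biUnion fun T _ => (hEct T _).image _)
  have hZ : #(Set.range fun n => e (z n)) ≤ (2 : Cardinal.{u}) ^ ℵ₀ :=
    (Set.countable_range _).le_aleph0.trans (cantor ℵ₀).le
  obtain ⟨K, ⟨hK, hZK, hHK⟩, hwin⟩ := h Y hY hκ _ (isMuClub_seqClosed hH hZ) _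
    (decidedAt_subset _ _ _) (not_IIHasWinningStrategy_diagonal d hd)
  have hlift : ∀ s : ℕ → A, (∀ n, s n ∈ (fun y => (d y).1) '' K) →
      ∃ y : ℕ → Y, (∀ n, y n ∈ K) ∧ (fun n => (d (y n)).1) = s := fun s hs => by
    choose y hy hys using hs
    exact ⟨y, hy, funext hys⟩
  set B : Set A := (fun y => (d y).1) '' K with hB
  have heB : ∀ X : Set A, e '' X ⊆ K → X ⊆ B := fun X hX x hx =>
    ⟨e x, hX ⟨x, hx, rfl⟩, he x⟩
  have hzB : Set.range z ⊆ B := by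
    rintro _ ⟨n, rfl⟩
    exact ⟨e (z n), hZK ⟨n, rfl⟩, he _⟩
  have hzinf : (Set.range z).Infinite :=
    Set.infinite_range_of_injective (Infinite.natEmbedding A).injective
  refine ⟨B, mk_image_le.trans hK, hzinf.mono hzB, fun s hs => ?_, fun s hs T hT =>
    ⟨fun hstat => ?_, fun hstat => ?_⟩⟩
  · obtain ⟨y, hy, rfl⟩ := hlift s hs
    exact heB _ ((Set.subset_union_left.trans Set.subset_union_left).trans (hHK y hy))
  · obtain ⟨y, hy, rfl⟩ := hlift s hs
    by_contra hns
    have hmem : code T ∈ K := hHK y hy (Or.inl (Or.inr ⟨T, hT, rfl⟩))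
    refine hwin (IIHasWinningStrategy_diagonal d hmem (by rwa [hcode]) ?_ (by rwa [hcode]))
    refine ⟨(fun x : B => (x : A)) ⁻¹' Set.range z, image_val_mem_ctblSubsets.1 ?_⟩
    rw [Set.image_preimage_eq_of_subset (hzB.trans Subtype.range_coe.ge)]
    exact ⟨Set.countable_range _, hzinf⟩
  · by_contra hns
    obtain ⟨hC, hTC, -⟩ := hE T ∅ (hSs s T hT) hns
    refine absurd (hstat.2 _ (hC.trace (B := B) fun U hU hUB => ?_)) ?_
    · obtain ⟨u, rfl⟩ := hU.1.exists_eq_range hU.2.nonempty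
      obtain ⟨y, hy, rfl⟩ := hlift s hs
      obtain ⟨y', hy', rfl⟩ := hlift u fun n => hUB ⟨n, rfl⟩
      obtain ⟨h1, h2⟩ := (hE T _ (hSs _ T hT) hns).2.2 hU
      refine ⟨_, h1, h2, heB _ ?_⟩
      let q : ℕ → Y := fun n => if n % 2 = 0 then y (n / 2) else y' (n / 2)
      have hq : ∀ n, q n ∈ K := fun n => by
        simp only [q]
        split_ifs
        exacts [hy _, hy' _]
      have hq0 : ∀ n, q (2 * n) = y n := fun n => by simp [q]
      have hq1 : ∀ n, q (2 * n + 1) = y' n := fun n => by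
        have h3 : (2 * n + 1) % 2 = 1 := by omega
        have h4 : (2 * n + 1) / 2 = n := by omega
        simp [q, h3, h4]
      have := Set.subset_union_right.trans (hHK q hq)
      simp only [hq0, hq1] at this
      exact (Set.subset_biUnion_of_mem
        (u := fun T => e '' E T (Set.range fun n => (d (y' n)).1)) hT).trans this
    · rintro ⟨X, hX1, hX2⟩
      exact hTC ⟨_, hX1, hX2⟩

/-! ### Countability of stationary logic -/

namespace StatFormula

variable {L : FirstOrder.Language.{v, w}}

/-- The nesting depth of a formula. -/
def depth : {m n : ℕ} → StatFormula L m n → ℕ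
  | _, _, .falsum => 0
  | _, _, .equal _ _ => 0
  | _, _, .rel _ _ => 0
  | _, _, .mem _ _ => 0
  | _, _, .imp φ ψ => max φ.depth ψ.depth + 1
  | _, _, .all φ => φ.depth + 1
  | _, _, .stat φ => φ.depth + 1

theorem countable_of_countable_symbols (hL : Countable L.Symbols) (m n : ℕ) :
    Countable (StatFormula L m n) := by
  have hterm : ∀ m : ℕ, Countable (L.Term (Fin m)) := fun m => by
    rw [← mk_le_aleph0_iff]
    refine FirstOrder.Language.Term.card_le.trans (max_le le_rfl ?_)
    rw [mk_le_aleph0_iff]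
    infer_instance
  have hrel : Countable (Σ k, L.Relations k) :=
    Function.Injective.countable (Sum.inr_injective : Function.Injective
      (Sum.inr : (Σ k, L.Relations k) → L.Symbols))
  have hrel' : ∀ k, Countable (L.Relations k) := fun k =>
    Function.Injective.countable (sigma_mk_injective (i := k))
  have hd : ∀ d m n : ℕ, {φ : StatFormula L m n | φ.depth < d}.Countable := by
    intro d
    induction d with
    | zero => simp
    | succ d ih =>
      intro m n
      refine Set.Countable.mono (s₂ := {falsum} ∪
        Set.range (fun p : L.Term (Fin m) × L.Term (Fin m) => equal p.1 p.2) ∪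
        Set.range (fun p : Σ k, L.Relations k × (Fin k → L.Term (Fin m)) => rel p.2.1 p.2.2) ∪
        Set.range (fun p : Fin m × Fin n => mem p.1 p.2) ∪
        Set.image2 imp {φ | φ.depth < d} {φ | φ.depth < d} ∪
        all '' {φ | φ.depth < d} ∪ stat '' {φ | φ.depth < d}) ?_ ?_
      · intro φ hφ
        cases φ with
        | falsum => simp
        | equal s t => exact .inl <| .inl <| .inl <| .inl <| .inl <| .inr ⟨(s, t), rfl⟩
        | rel R ts => exact .inl <| .inl <| .inl <| .inl <| .inr ⟨⟨_, R, ts⟩, rfl⟩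
        | mem x X => exact .inl <| .inl <| .inl <| .inr ⟨(x, X), rfl⟩
        | imp φ ψ =>
          have h := max_lt_iff.1 (Nat.lt_of_succ_lt_succ hφ)
          exact .inl <| .inl <| .inr ⟨φ, h.1, ψ, h.2, rfl⟩
        | all φ => exact .inl <| .inr ⟨φ, Nat.lt_of_succ_lt_succ hφ, rfl⟩
        | stat φ => exact .inr ⟨φ, Nat.lt_of_succ_lt_succ hφ, rfl⟩
      · exact ((((((Set.countable_singleton _).union (Set.countable_range _)).union
          (Set.countable_range _)).union (Set.countable_range _)).union
          ((ih m n).image2 (ih m n) _)).union ((ih (m + 1) n).image _)).union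
          ((ih m (n + 1)).image _)
  have huniv : (Set.univ : Set (StatFormula L m n)) = ⋃ d, {φ | φ.depth < d} := by
    ext φ
    simpa using ⟨_, Nat.lt_succ_self φ.depth⟩
  rw [← Set.countable_univ_iff, huniv]
  exact Set.countable_iUnion fun d => hd d m n

end StatFormula

/-! ### Elementarity for stationary logic -/

section elementary

variable {L : FirstOrder.Language.{v, w}} {A : Type u} [L.Structure A]

/-- The family of countable sets quantified over by `stat φ`. -/
def statFamily {m n : ℕ} (φ : StatFormula L m (n + 1)) (a : Fin m → A) (U : Fin n → Set A) :
    Set (Set A) :=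
  {X | X ∈ ctblSubsets A ∧ φ.Realize a (Fin.snoc U X)}

/-- A Tarski–Vaught test for stationary logic. -/
theorem isStatElementary_of_witnesses_of_reflection {B : L.Substructure A}
    (hall : ∀ (m n : ℕ) (φ : StatFormula L (m + 1) n) (b : Fin m → B) (U : Fin n → Set B),
      (∀ i, U i ∈ ctblSubsets B) →
      (∃ x : A, ¬ φ.Realize (Fin.snoc (fun i => (b i : A)) x)
        fun i => (fun x : B => (x : A)) '' U i) →
      ∃ x : B, ¬ φ.Realize (Fin.snoc (fun i => (b i : A)) (x : A))
        fun i => (fun x : B => (x : A)) '' U i)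
    (hstat : ∀ (m n : ℕ) (φ : StatFormula L m (n + 1)) (b : Fin m → B) (U : Fin n → Set B),
      (∀ i, U i ∈ ctblSubsets B) →
      (IsStationaryCtbl (statFamily φ (fun i => (b i : A))
          fun i => (fun x : B => (x : A)) '' U i) ↔
        IsStationaryCtbl (trace (B : Set A) (statFamily φ (fun i => (b i : A))
          fun i => (fun x : B => (x : A)) '' U i)))) :
    IsStatElementary B := by
  intro m n φ
  have hterm : ∀ {m : ℕ} (t : L.Term (Fin m)) (b : Fin m → B),
      t.realize (fun i => (b i : A)) = (t.realize b : B) := fun t b =>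
    FirstOrder.Language.HomClass.realize_term B.subtype (t := t) (v := b)
  induction φ with
  | falsum => exact fun _ _ _ => Iff.rfl
  | equal s t =>
    intro b U _
    simp only [StatFormula.Realize, hterm]
    exact Subtype.val_injective.eq_iff.symm
  | rel R ts =>
    intro b U _
    simp only [StatFormula.Realize, hterm]
    exact Iff.rfl
  | mem x X =>
    intro b U _
    simp only [StatFormula.Realize]
    exact (Subtype.val_injective.mem_set_image).symm
  | imp φ ψ ihφ ihψ =>
    intro b U hU
    simp only [StatFormula.Realize]
    rw [ihφ b U hU, ihψ b U hU]
  | @all m n φ ih =>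
    intro b U hU
    have hsnoc : ∀ x : B, (fun i => ((Fin.snoc b x : Fin (m + 1) → B) i : A)) =
        (Fin.snoc (fun i => (b i : A)) (x : A) : Fin (m + 1) → A) := fun x =>
      Fin.comp_snoc (fun x : B => (x : A)) b x
    simp only [StatFormula.Realize]
    constructor
    · intro h
      by_contra! hx
      obtain ⟨x, hx⟩ := hall m n φ b U hU hx
      refine hx ?_
      have := (ih (Fin.snoc b x) U hU).1 (h x)
      rwa [hsnoc] at this
    · intro h x
      rw [ih _ U hU, hsnoc]
      exact h x
  | @stat m n φ ih =>
    intro b U hU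
    have hsnoc : ∀ X : Set B, (fun i => (fun x : B => (x : A)) ''
          (Fin.snoc U X : Fin (n + 1) → Set B) i) =
        (Fin.snoc (fun i => (fun x : B => (x : A)) '' U i) ((fun x : B => (x : A)) '' X) :
          Fin (n + 1) → Set A) := fun X =>
      Fin.comp_snoc (Set.image fun x : B => (x : A)) U X
    simp only [StatFormula.Realize]
    refine Iff.trans (iff_of_eq (congrArg _ ?_)) (hstat m n φ b U hU).symm
    ext X
    refine and_congr_right_iff.2 (fun hX => ?_) |>.trans
      (and_congr_left' (image_val_mem_ctblSubsets (B := (B : Set A))).symm)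
    have hUX : ∀ i, (Fin.snoc U X : Fin (n + 1) → Set B) i ∈ ctblSubsets B := fun i => by
      refine Fin.lastCases ?_ (fun i => ?_) i
      · simpa using hX
      · simpa using hU i
    rw [ih b _ hUX, hsnoc]
    rfl

/-- The values of `m` first-order variables coded by `s`: its first `m` entries of even index. -/
def argsOf (m : ℕ) (s : ℕ → A) : Fin m → A := fun i => s (2 * i)

/-- The values of `n` second-order variables coded by `s`: each is enumerated by one column of the
array formed by the entries of odd index. -/
def setsOf (n : ℕ) (s : ℕ → A) : Fin n → Set A :=
  fun j => Set.range fun i => s (2 * Nat.pair j i + 1)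

theorem exists_argsOf_setsOf_eq {B : Set A} (hB : B.Nonempty) {m n : ℕ} (b : Fin m → A)
    (hb : ∀ i, b i ∈ B) (U : Fin n → Set A) (hU : ∀ i, U i ∈ ctblSubsets A) (hUB : ∀ i, U i ⊆ B) :
    ∃ s : ℕ → A, (∀ k, s k ∈ B) ∧ argsOf m s = b ∧ setsOf n s = U := by
  obtain ⟨b₀, hb₀⟩ := hB
  have henum : ∀ j, ∃ f : ℕ → A, U j = Set.range f := fun j =>
    (hU j).1.exists_eq_range (hU j).2.nonempty
  choose f hf using henum
  let s₁ : ℕ → A := fun k => if h : k < m then b ⟨k, h⟩ else b₀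
  let s₂ : ℕ → A := fun k => if h : k.unpair.1 < n then f ⟨_, h⟩ k.unpair.2 else b₀
  refine ⟨fun k => if k % 2 = 0 then s₁ (k / 2) else s₂ (k / 2), fun k => ?_, ?_, ?_⟩
  · dsimp only [s₁, s₂]
    split_ifs
    exacts [hb _, hb₀, hUB _ (hf _ ▸ Set.mem_range_self _), hb₀]
  · funext i
    simp [argsOf, s₁]
  · funext j
    have h1 : ∀ k, (2 * k + 1) % 2 = 1 := by omega
    have h2 : ∀ k, (2 * k + 1) / 2 = k := by omega
    simp [setsOf, h1, h2, s₂, hf]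

end elementary

/-- The reflecting set `B` is chosen closed under Skolem functions and reflecting for all the
families `statFamily φ` with parameters from `B`. -/
theorem SDLSStatLE_of_GRPLT (h : GRPLT.{u} (Order.succ (2 ^ ℵ₀))) :
    SDLSStatLE.{u, v, w} (2 ^ ℵ₀) := by
  intro L hL A _ hA
  have : Infinite A := infinite_iff.2 hA.le
  have hL' : Countable L.Symbols := mk_le_aleph0_iff.1 hL
  have hφ := StatFormula.countable_of_countable_symbols hL'
  -- `wit` gives a counterexample to `all φ`, if there is one.
  have hwit : ∀ (m n : ℕ) (φ : StatFormula L (m + 1) n) (a : Fin m → A) (U : Fin n → Set A),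
      ∃ x : A, (∃ x, ¬ φ.Realize (Fin.snoc a x) U) → ¬ φ.Realize (Fin.snoc a x) U :=
    fun m n φ a U => by
      by_cases hx : ∃ x, ¬ φ.Realize (Fin.snoc a x) U
      · exact ⟨hx.choose, fun _ => hx.choose_spec⟩
      · exact ⟨Classical.arbitrary A, fun h => (hx h).elim⟩
  choose wit hwit using hwit
  let G : (ℕ → A) → Set A := fun s =>
    Set.range (fun f : Σ k, L.Functions k => FirstOrder.Language.Structure.funMap f.2
      (argsOf f.1 s)) ∪
    Set.range fun φ : Σ (m : ℕ) (n : ℕ), StatFormula L (m + 1) n =>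
      wit _ _ φ.2.2 (argsOf _ s) (setsOf _ s)
  let S : (ℕ → A) → Set (Set (Set A)) := fun s =>
    Set.range fun φ : Σ (m : ℕ) (n : ℕ), StatFormula L m (n + 1) =>
      statFamily φ.2.2 (argsOf _ s) (setsOf _ s)
  obtain ⟨B, hB, hBinf, hBG, hBS⟩ := exists_reflecting_of_GRPLT h G
    (fun s => (Set.countable_range _).union (Set.countable_range _)) S
    (fun s => Set.countable_range _) (by rintro s _ ⟨φ, rfl⟩ X hX; exact hX.1)
  let B' : L.Substructure A := ⟨B, fun {k} f x hx => by
    obtain ⟨s, hs, rfl, -⟩ := exists_argsOf_setsOf_eq hBinf.nonempty x hx (n := 0)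
      (fun _ => ∅) (fun i => i.elim0) fun i => i.elim0
    exact hBG s hs (Or.inl ⟨⟨k, f⟩, rfl⟩)⟩
  have hcode : ∀ {m n : ℕ} (b : Fin m → B') (U : Fin n → Set B'), (∀ i, U i ∈ ctblSubsets B') →
      ∃ s : ℕ → A, (∀ k, s k ∈ B) ∧ argsOf m s = (fun i => (b i : A)) ∧
        setsOf n s = fun i => (fun x : B' => (x : A)) '' U i := fun b U hU =>
    exists_argsOf_setsOf_eq hBinf.nonempty _ (fun i => (b i).2) _
      (fun i => (image_val_mem_ctblSubsets (B := B)).2 (hU i))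
      fun i => by rintro _ ⟨x, -, rfl⟩; exact x.2
  refine ⟨B', Order.lt_succ_of_le hB, isStatElementary_of_witnesses_of_reflection ?_ ?_⟩
  · intro m n φ b U hU hx
    obtain ⟨s, hs, h1, h2⟩ := hcode b U hU
    rw [← h1, ← h2] at hx ⊢
    exact ⟨⟨_, hBG s hs (Or.inr ⟨⟨m, n, φ⟩, rfl⟩)⟩, hwit _ _ _ _ _ hx⟩
  · intro m n φ b U hU
    obtain ⟨s, hs, h1, h2⟩ := hcode b U hU
    rw [← h1, ← h2]
    exact hBS s hs _ ⟨⟨m, n, φ⟩, rfl⟩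

theorem mainTheorem12 :
    (GRP.{u} → SDLSStatLT.{u, v, w} (aleph.{u} 2)) ∧
      (GRPLT.{u} (Order.succ (2 ^ aleph0.{u})) → SDLSStatLE.{u, v, w} (2 ^ aleph0.{u})) := by
  refine ⟨fun h => ?_, SDLSStatLE_of_GRPLT⟩
  have h2 : aleph.{u} 2 = Order.succ (aleph 1) := by
    rw [succ_aleph, one_add_one_eq_two]
  have hlt : (2 : Cardinal.{u}) ^ ℵ₀ < aleph 2 :=
    two_pow_aleph0_lt_of_GRPLT (h2 ▸ isRegular_succ (aleph0_le_aleph 1)) h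
  -- So the continuum hypothesis holds, and the first claim becomes an instance of the second.
  have hCH : aleph.{u} 1 = 2 ^ ℵ₀ := by
    refine le_antisymm ?_ (Order.le_of_lt_succ (h2 ▸ hlt))
    rw [← succ_aleph0]
    exact Order.succ_le_of_lt (cantor ℵ₀)
  have h3 : aleph.{u} 2 = Order.succ (2 ^ ℵ₀) := by rw [h2, hCH]
  rw [h3]
  rw [GRP, h3] at h
  exact SDLSStatLE_of_GRPLT h
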